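/- For $0<\alpha\le\pi/2$ let $S_\alpha=\{z\in\mathbb C:\operatorname{Re}z>0,\ |\arg z|<\alpha\}$, and let $H(S_\alpha)$ be the Fréchet space of holomorphic functions on $S_\alpha$ with the topology of local uniform convergence, $H(S_\alpha)'$ its dual. The spectral radius of an element $b$ of a (not necessarily unital) complex Banach algebra is denoted by $\rho(b)$, and $\operatorname{rad}\mathcal A=\{a\in\mathcal A:\rho(a)=0\}$ for a commutative Banach algebra $\mathcal A$. **Theorem.** Let $0\le\beta<\alpha<\pi/2$. Let $\phi\in H(S_\alpha)'$ be induced by a complex Borel measure $\mu$ with compact support contained in $\{\xi\in S_\alpha:|\arg\xi|\le\beta\}$, that is, $\langle g,\phi\rangle=\int_{S_\alpha}g\,d\mu$ for all $g\in H(S_\alpha)$. Suppose that $\mu$ is symmetric, i.e. $\mu(\overline S)=\overline{\mu(S)}$ for all Borel sets $S\subseteq S_\alpha$, and that $\mu(S_\alpha)=0$. Let $f(z)=\langle e^{-z\,\cdot},\phi\rangle=\int_{S_\alpha}e^{-z\xi}\,d\mu(\xi)$ $(z\in\mathbb C)$ be the Fourier–Borel transform of $\phi$. Let $(T(t))_{t\in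 S_\alpha}$ be an analytic semigroup in a complex Banach algebra $B$ (i.e. $T:S_\alpha\to B$ is complex-differentiable in norm and $T(s+t)=T(s)T(t)$ for all $s,t\in S_\alpha$) which is not quasinilpotent (i.e. $\rho(T(t))\neq0$ for some $t\in S_\alpha$). Let $\mathcal A$ be the closed subalgebra of $B$ generated by $\{T(t):t\in S_\alpha\}$ (it is commutative), and $\pi:\mathcal A\to\mathcal A/\operatorname{rad}\mathcal A$ the canonical surjection. For $t\in S_{\alpha-\beta}$ put $$f(-tA)=\int_{S_\alpha}T(t\xi)\,d\mu(\xi),$$ a Bochner integral, which is defined because $t\xi\in S_\alpha$ for every $\xi$ in the support of $\mu$. If there exists $t_0>0$ such that $$\sup_{t\in S_{\alpha-\beta},\ |t|\le t_0}\rho\bigl(f(-tA)\bigr)<\sup_{z\in S_{\alpha-\beta}}|f(z)|,$$ then $\mathcal A/\operatorname{rad}\mathcal A$ is unital, and the semigroup $(\pi(T(t)))_{t\in S_\alpha}$ has a bounded generator: there is $u\in\mathcal A/\operatorname{rad}\mathcal A$ such that $\pi(T(t))=\exp(tu)$ for all $t\in S_\alpha$. -/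

import Mathlib

open MeasureTheory
open scoped ENNReal NNReal ComplexConjugate

noncomputable section

/-- The open sector `S_α = {z : Re z > 0, |arg z| < α}`. -/
def sector (α : ℝ) : Set ℂ := {z | 0 < z.re ∧ |z.arg| < α}

/-! ### Complex measures -/

/-- The (Bochner) integral of a vector-valued function against a complex measure `μ`, by means of
the Jordan decompositions of the real and the imaginary part of `μ`. -/
def cintegral {X E : Type*} [MeasurableSpace X] [NormedAddCommGroup E] [NormedSpace ℂ E]
    (μ : ComplexMeasure X) (g : X → E) : E :=
  ((∫ x, g x ∂(ComplexMeasure.re μ).toJordanDecomposition.posPart)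
      - ∫ x, g x ∂(ComplexMeasure.re μ).toJordanDecomposition.negPart)
    + Complex.I •
      ((∫ x, g x ∂(ComplexMeasure.im μ).toJordanDecomposition.posPart)
        - ∫ x, g x ∂(ComplexMeasure.im μ).toJordanDecomposition.negPart)

/-- The complex measure `μ` is carried by the set `K`. -/
def CarriedBy {X : Type*} [MeasurableSpace X] (μ : ComplexMeasure X) (K : Set X) : Prop :=
  ∀ S : Set X, MeasurableSet S → Disjoint S K → μ S = 0

/-- `μ ∈ M_c(X)`: the complex Borel measure `μ` on `X` has compact support. -/
def HasCompactSupp {X : Type*} [TopologicalSpace X] [MeasurableSpace X]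
    (μ : ComplexMeasure X) : Prop :=
  ∃ K : Set X, IsCompact K ∧ CarriedBy μ K

theorem conj_mem_sector {α : ℝ} {z : ℂ} (hz : z ∈ sector α) : conj z ∈ sector α := by
  refine ⟨by simpa using hz.1, ?_⟩
  have h : z.arg ≠ Real.pi := by
    intro h
    have := (Complex.arg_eq_pi_iff.1 h).1
    linarith [hz.1]
  rw [Complex.arg_conj, if_neg h, abs_neg]
  exact hz.2

/-- Complex conjugation as a map of the sector to itself. -/
def sectorConj (α : ℝ) (ξ : sector α) : sector α := ⟨conj (ξ : ℂ), conj_mem_sector ξ.2⟩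

/-- A complex Borel measure on the sector is symmetric if `μ (conj S) = conj (μ S)`. -/
def IsSymmetricMeasure {α : ℝ} (μ : ComplexMeasure (sector α)) : Prop :=
  ∀ S : Set (sector α), MeasurableSet S → μ (sectorConj α '' S) = conj (μ S)

/-! ### Holomorphic functions on the sector, analytic functionals, Fourier-Borel transform -/

/-- The space `H(S_α)` of holomorphic functions on the sector, with the topology of locally uniform
convergence (the compact-open topology induced from the space of continuous functions). -/
def holomorphicOnSector (α : ℝ) : Submodule ℂ C(sector α, ℂ) where
  carrier := {g | ∃ G : ℂ → ℂ, DifferentiableOn ℂ G (sector α) ∧ ∀ ξ : sector α, g ξ = G ξ}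
  add_mem' := by
    rintro g h ⟨G, hG, hg⟩ ⟨H, hH, hh⟩
    exact ⟨G + H, hG.add hH, fun ξ => by simp [hg, hh]⟩
  zero_mem' := ⟨0, differentiableOn_const 0, fun ξ => rfl⟩
  smul_mem' := by
    rintro c g ⟨G, hG, hg⟩
    exact ⟨c • G, hG.const_smul c, fun ξ => by simp [hg]⟩

/-- The exponential `e_{-z} : ξ ↦ exp (-z ξ)` as an element of `H(S_α)`. -/
def expNeg (α : ℝ) (z : ℂ) : holomorphicOnSector α :=
  ⟨⟨fun ξ => Complex.exp (-z * ξ), by fun_prop⟩,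
    fun ξ => Complex.exp (-z * ξ), by fun_prop, fun _ => rfl⟩

/-- The Fourier-Borel transform `z ↦ ⟨e_{-z}, φ⟩` of `φ ∈ H(S_α)'`. -/
def fourierBorel {α : ℝ} (φ : holomorphicOnSector α →L[ℂ] ℂ) (z : ℂ) : ℂ := φ (expNeg α z)

/-- The functional `φ ∈ H(S_α)'` is induced by the measure `μ`: `⟨g, φ⟩ = ∫ g dμ`. -/
def IsInducedBy {α : ℝ} (φ : holomorphicOnSector α →L[ℂ] ℂ) (μ : ComplexMeasure (sector α)) :
    Prop :=
  ∀ g : holomorphicOnSector α, φ g = cintegral μ (fun ξ => (g : C(sector α, ℂ)) ξ)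

/-! ### Spectral radius and radical -/

/-- The spectral radius of an element of a complex Banach algebra that need not have a unit; the
quasispectrum is the spectrum in the unitization. -/
def rho {B : Type*} [NonUnitalRing B] [Module ℂ B] (b : B) : ℝ≥0∞ :=
  ⨆ k ∈ quasispectrum ℂ b, (‖k‖₊ : ℝ≥0∞)

theorem rho_eq_zero_iff {B : Type*} [NonUnitalRing B] [Module ℂ B] (b : B) :
    rho b = 0 ↔ ∀ k ∈ quasispectrum ℂ b, k = 0 := by
  simp [rho]

section Radical

variable (C : Type*) [NonUnitalNormedCommRing C] [NormedSpace ℂ C] [IsScalarTower ℂ C C]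
  [SMulCommClass ℂ C C] [CompleteSpace C]

/-- In a commutative Banach algebra the quasinilpotent elements are those that are killed by all
characters of the unitization. -/
theorem rho_eq_zero_iff_forall_algHom (a : C) :
    rho a = 0 ↔ ∀ f : Unitization ℂ C →ₐ[ℂ] ℂ, f (a : Unitization ℂ C) = 0 := by
  rw [rho_eq_zero_iff, Unitization.quasispectrum_eq_spectrum_inr]
  constructor
  · intro h f
    exact h _ (AlgHom.apply_mem_spectrum f _)
  · intro h k hk
    let _ : NormedCommRing (WithLp 1 (Unitization ℂ C)) :=
      { WithLp.instUnitizationNormedRing (𝕜 := ℂ) (A := C) with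
        mul_comm := fun x y => by
          apply (WithLp.unitizationAlgEquiv (𝕜 := ℂ) (A := C) ℂ).injective
          rw [map_mul, map_mul, mul_comm] }
    have hk' : k ∈ spectrum ℂ
        ((WithLp.unitizationAlgEquiv (𝕜 := ℂ) (A := C) ℂ).symm (a : Unitization ℂ C)) := by
      rwa [AlgEquiv.spectrum_eq]
    obtain ⟨f, hf⟩ := WeakDual.CharacterSpace.mem_spectrum_iff_exists.1 hk'
    have := h ((WeakDual.CharacterSpace.toAlgHom f).comp
      (WithLp.unitizationAlgEquiv (𝕜 := ℂ) (A := C) ℂ).symm.toAlgHom)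
    rw [← hf]
    exact this

/-- The radical of a commutative complex Banach algebra: the set of all elements with spectral
radius zero. -/
def radical : Submodule ℂ C where
  carrier := {a | rho a = 0}
  add_mem' := by
    intro a b ha hb
    simp only [Set.mem_ofPred_eq, rho_eq_zero_iff_forall_algHom] at *
    intro f
    rw [Unitization.inr_add, map_add, ha f, hb f, add_zero]
  zero_mem' := by
    simp only [Set.mem_ofPred_eq, rho_eq_zero_iff_forall_algHom]
    intro f
    rw [Unitization.inr_zero, map_zero]
  smul_mem' := by
    intro c a ha
    simp only [Set.mem_ofPred_eq, rho_eq_zero_iff_forall_algHom] at *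
    intro f
    rw [Unitization.inr_smul, map_smul, ha f, smul_zero]

variable {C}

theorem mul_mem_radical_left {a : C} (b : C) (ha : a ∈ radical C) : b * a ∈ radical C := by
  change rho a = 0 at ha
  change rho (b * a) = 0
  rw [rho_eq_zero_iff_forall_algHom] at *
  intro f
  rw [Unitization.inr_mul, map_mul, ha f, mul_zero]

/-- The radical is closed, so that the quotient norm on `C / rad C` is a norm. -/
instance isClosed_radical : IsClosed (radical C : Set C) := by
  have h : (radical C : Set C) = ⋂ f : Unitization ℂ C →ₐ[ℂ] ℂ,
      {a : C | f (a : Unitization ℂ C) = 0} := by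
    ext a
    rw [Set.mem_iInter]
    exact rho_eq_zero_iff_forall_algHom C a
  rw [h]
  refine isClosed_iInter fun f => ?_
  have hf : Continuous
      (f.comp (WithLp.unitizationAlgEquiv (𝕜 := ℂ) (A := C) ℂ).toAlgHom) :=
    map_continuous _
  exact isClosed_eq (hf.comp (WithLp.unitization_isometry_inr (𝕜 := ℂ)).continuous)
    continuous_const

/-- The quotient algebra `C / rad C`, with the quotient norm. -/
abbrev ModRadical (C : Type*) [NonUnitalNormedCommRing C] [NormedSpace ℂ C] [IsScalarTower ℂ C C]
    [SMulCommClass ℂ C C] [CompleteSpace C] : Type _ := C ⧸ radical C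

/-- The product of `C / rad C`, induced by that of `C`. -/
instance : Mul (ModRadical C) where
  mul := Quotient.map₂ (fun a b => a * b) (by
    intro a a' haa b b' hbb
    have h1 : a - a' ∈ radical C := (Submodule.quotientRel_def _).1 haa
    have h2 : b - b' ∈ radical C := (Submodule.quotientRel_def _).1 hbb
    refine (Submodule.quotientRel_def _).2 ?_
    have : a * b - a' * b' = b * (a - a') + a' * (b - b') := by
      rw [mul_sub, mul_sub, mul_comm b a, mul_comm b a']; abel
    rw [this]
    exact add_mem (mul_mem_radical_left _ h1) (mul_mem_radical_left _ h2))

/-- The canonical surjection `π : C → C / rad C`. -/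
def modRad (a : C) : ModRadical C := (radical C).mkQ a

theorem modRad_mul (a b : C) : modRad (a * b) = modRad a * modRad b := rfl

end Radical

/-! ### Analytic semigroups on the sector -/

/-- An analytic semigroup `(T(t))_{t ∈ S_α}` in a Banach algebra `B`; the values of `toFun` off the
sector are irrelevant. -/
structure AnalyticSemigroup (α : ℝ) (B : Type*) [NonUnitalNormedRing B] [NormedSpace ℂ B] where
  toFun : ℂ → B
  differentiableOn : DifferentiableOn ℂ toFun (sector α)
  map_add : ∀ s ∈ sector α, ∀ t ∈ sector α, toFun (s + t) = toFun s * toFun t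

namespace AnalyticSemigroup

variable {α : ℝ} {B : Type*} [NonUnitalNormedRing B] [NormedSpace ℂ B] [IsScalarTower ℂ B B]
  [SMulCommClass ℂ B B]

/-- The semigroup is quasinilpotent if all its elements have spectral radius zero. -/
def IsQuasinilpotent (T : AnalyticSemigroup α B) : Prop := ∀ t ∈ sector α, rho (T.toFun t) = 0

/-- The closed subalgebra generated by the semigroup. -/
def algebra (T : AnalyticSemigroup α B) : NonUnitalSubalgebra ℂ B :=
  (NonUnitalAlgebra.adjoin ℂ (T.toFun '' sector α)).topologicalClosure

theorem mem_algebra (T : AnalyticSemigroup α B) (t : sector α) : T.toFun t ∈ T.algebra :=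
  NonUnitalSubalgebra.le_topologicalClosure _
    (NonUnitalAlgebra.subset_adjoin ℂ (Set.mem_image_of_mem _ t.2))

/-- The elements of the semigroup, as elements of the closed subalgebra they generate. -/
def elem (T : AnalyticSemigroup α B) (t : sector α) : T.algebra := ⟨T.toFun t, T.mem_algebra t⟩

theorem algebra_mul_comm (T : AnalyticSemigroup α B) (x y : T.algebra) : x * y = y * x := by
  have hcomm : ∀ x y : NonUnitalAlgebra.adjoin ℂ (T.toFun '' sector α), x * y = y * x :=
    (NonUnitalAlgebra.adjoinNonUnitalCommRingOfComm ℂ (by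
      rintro _ ⟨s, hs, rfl⟩ _ ⟨t, ht, rfl⟩
      rw [← T.map_add s hs t ht, ← T.map_add t ht s hs, add_comm])).mul_comm
  exact (NonUnitalSubalgebra.nonUnitalCommRingTopologicalClosure _ hcomm).mul_comm x y

instance (T : AnalyticSemigroup α B) : NonUnitalNormedCommRing T.algebra :=
  { NonUnitalSubalgebra.nonUnitalNormedRing T.algebra with
    mul_comm := T.algebra_mul_comm }

instance (T : AnalyticSemigroup α B) : NormedSpace ℂ T.algebra where
  norm_smul_le c x := norm_smul_le c (x : B)

instance [CompleteSpace B] (T : AnalyticSemigroup α B) : CompleteSpace T.algebra :=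
  (NonUnitalSubalgebra.isClosed_topologicalClosure _).completeSpace_coe

/-- The functional calculus `f(-tA) = ∫ T(tξ) dμ(ξ)`, where `f` is the Fourier-Borel transform of
the functional induced by `μ` and `A` is the generator of `T`. It is meant for those `t` for
which `tξ` is in the sector for all `ξ` in the support of `μ`. -/
def calculus (T : AnalyticSemigroup α B) (μ : ComplexMeasure (sector α)) (t : ℂ) : B :=
  cintegral μ (fun ξ => T.toFun (t * ξ))

end AnalyticSemigroup

/-- `e` is a unit element. -/
def IsUnitElement {Q : Type*} [Mul Q] (e : Q) : Prop := ∀ x : Q, e * x = x ∧ x * e = x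

/-- `w = exp v = e + ∑_{n ≥ 1} v ^ n / n!` in an algebra with unit element `e`; the iterate of the
multiplication by `v` gives `v ^ n`. -/
def IsExp {Q : Type*} [Mul Q] [AddCommMonoid Q] [Module ℂ Q] [TopologicalSpace Q] (e v w : Q) :
    Prop :=
  HasSum (fun n : ℕ => ((n.factorial : ℂ)⁻¹) • ((fun x => v * x)^[n] e)) w

end

noncomputable section

/-! ### Integration against complex measures -/

/-! Modulo the radical, the algebra generated by the semigroup is determined by its characters. A
character that is not identically zero restricts to a holomorphic solution of `h (s + t) = h s * h
t`, so it is `t ↦ exp (c * t)` on the semigroup (`char_eq_zero_or_exp`). Everything depends on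
whether these exponents `c` are bounded.

If they are bounded, then for small `r > 0` the Gelfand transform of `T(r)` takes values in a small
disc about 1, apart from the possible value 0. Cauchy integrals of `1` and of `log z / r` over the
boundary of such a disc give a unit and a generator modulo the radical
(`exists_generator_of_bounded`).

If they are unbounded, let `-c / |c|` tend to `ω` along a sequence with `|c| → ∞`. Since `|exp (c *
t)| ≤ ‖T(t)‖`, the direction `ω` lies in the closed polar sector `|arg ω| ≤ π/2 - α`. A character
sends `f(-tA)` to `f(-c * t)`, so `|f(-c * t)|` is at most the supremum `m` of the spectral radii;
taking `t = s / |c|` yields `|f| ≤ m` on `ω S_{α-β}` (`exists_rotation_of_unbounded`). By symmetry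
of `μ` the same holds on the conjugate sector, and `f` is bounded on the polar sector, so
Phragmén-Lindelöf fills the gap between the two and `|f| ≤ m` on `S_{α-β}`
(`norm_le_on_sector_of_rotated`), contrary to the strict inequality. -/

theorem integrable_of_continuousOn_isCompact {X E : Type*} [MeasurableSpace X]
    [NormedAddCommGroup E] [TopologicalSpace X] [OpensMeasurableSpace X]
    [TopologicalSpace.PseudoMetrizableSpace X] {p : Measure X} [IsFiniteMeasure p] {K : Set X}
    (hK : IsCompact K) (hKm : MeasurableSet K) (hp : p Kᶜ = 0) {g : X → E}
    (hg : ContinuousOn g K) : Integrable g p := by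
  have : p.restrict K = p := Measure.restrict_eq_self_of_ae_mem (by
    rw [ae_iff]; exact hp)
  rw [← this]
  exact hg.integrableOn_compact' hK hKm

section ComplexMeasure

variable {X E F : Type*} [MeasurableSpace X] [NormedAddCommGroup E] [NormedSpace ℂ E]
  [NormedAddCommGroup F] [NormedSpace ℂ F]

/-- The four positive measures whose linear combination is the complex measure `μ`. -/
def jordanPart (μ : ComplexMeasure X) : Fin 4 → Measure X :=
  ![(ComplexMeasure.re μ).toJordanDecomposition.posPart,
    (ComplexMeasure.re μ).toJordanDecomposition.negPart,
    (ComplexMeasure.im μ).toJordanDecomposition.posPart,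
    (ComplexMeasure.im μ).toJordanDecomposition.negPart]

/-- The coefficients of the four Jordan parts of a complex measure. -/
def jordanCoeff : Fin 4 → ℂ := ![1, -1, Complex.I, -Complex.I]

theorem norm_jordanCoeff (i : Fin 4) : ‖jordanCoeff i‖ = 1 := by
  fin_cases i <;> simp [jordanCoeff]

instance isFiniteMeasure_jordanPart (μ : ComplexMeasure X) (i : Fin 4) :
    IsFiniteMeasure (jordanPart μ i) := by
  fin_cases i
  exacts [JordanDecomposition.posPart_finite _, JordanDecomposition.negPart_finite _,
    JordanDecomposition.posPart_finite _, JordanDecomposition.negPart_finite _]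

theorem cintegral_eq_sum (μ : ComplexMeasure X) (g : X → E) :
    cintegral μ g = ∑ i, jordanCoeff i • ∫ x, g x ∂(jordanPart μ i) := by
  simp only [cintegral, Fin.sum_univ_four, jordanCoeff, jordanPart]
  simp [smul_sub]
  abel

/-- The Jordan parts are, up to sign, `s` restricted to a Hahn set and to its complement; both
restrictions see only subsets of `N`. -/
theorem toJordanDecomposition_parts_eq_zero {s : SignedMeasure X} {N : Set X}
    (hN : MeasurableSet N) (h : ∀ S ⊆ N, MeasurableSet S → s S = 0) :
    s.toJordanDecomposition.posPart N = 0 ∧ s.toJordanDecomposition.negPart N = 0 := by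
  obtain ⟨i, hi, h0, h1, hp, hn⟩ := s.toJordanDecomposition_spec
  rw [hp, hn, SignedMeasure.toMeasureOfZeroLE_apply _ h0 hi hN,
    SignedMeasure.toMeasureOfLEZero_apply _ h1 hi.compl hN]
  constructor
  · rw [ENNReal.coe_eq_zero]
    ext
    exact h _ Set.inter_subset_right (hi.inter hN)
  · rw [ENNReal.coe_eq_zero]
    ext
    simp [h _ Set.inter_subset_right (hi.compl.inter hN)]

theorem CarriedBy.jordanPart_compl {μ : ComplexMeasure X} {K : Set X} (h : CarriedBy μ K)
    (hK : MeasurableSet K) (i : Fin 4) : jordanPart μ i Kᶜ = 0 := by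
  have hre := toJordanDecomposition_parts_eq_zero (s := ComplexMeasure.re μ) hK.compl
    (fun S hS hSm => by
      change (μ S).re = 0
      rw [h S hSm (Set.disjoint_left.2 fun x hx => hS hx), Complex.zero_re])
  have him := toJordanDecomposition_parts_eq_zero (s := ComplexMeasure.im μ) hK.compl
    (fun S hS hSm => by
      change (μ S).im = 0
      rw [h S hSm (Set.disjoint_left.2 fun x hx => hS hx), Complex.zero_im])
  fin_cases i
  exacts [hre.1, hre.2, him.1, him.2]

theorem cintegral_congr {μ : ComplexMeasure X} {g h : X → E}
    (H : ∀ i, g =ᵐ[jordanPart μ i] h) : cintegral μ g = cintegral μ h := by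
  simp only [cintegral_eq_sum]
  exact Finset.sum_congr rfl fun i _ => by rw [integral_congr_ae (H i)]

theorem ContinuousLinearMap.cintegral_comp_comm [CompleteSpace E] [CompleteSpace F]
    (L : E →L[ℂ] F) {μ : ComplexMeasure X}
    {g : X → E} (H : ∀ i, Integrable g (jordanPart μ i)) :
    cintegral μ (fun x => L (g x)) = L (cintegral μ g) := by
  simp only [cintegral_eq_sum, map_sum, map_smul]
  exact Finset.sum_congr rfl fun i _ => by rw [L.integral_comp_comm (H i)]

theorem norm_cintegral_le {μ : ComplexMeasure X} {g : X → E} {C : ℝ} (hg : ∀ x, ‖g x‖ ≤ C) :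
    ‖cintegral μ g‖ ≤ ∑ i, C * (jordanPart μ i).real Set.univ := by
  rw [cintegral_eq_sum]
  refine (norm_sum_le _ _).trans (Finset.sum_le_sum fun i _ => ?_)
  rw [norm_smul, norm_jordanCoeff, one_mul]
  exact norm_integral_le_of_norm_le_const (Filter.Eventually.of_forall hg)

/-- If two differences of finite measures define the same signed measure, then they give the same
integrals. -/
theorem integral_sub_eq_of_toSignedMeasure_sub_eq {p n q m : Measure X} [IsFiniteMeasure p]
    [IsFiniteMeasure n] [IsFiniteMeasure q] [IsFiniteMeasure m]
    (h : p.toSignedMeasure - n.toSignedMeasure = q.toSignedMeasure - m.toSignedMeasure)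
    {g : X → E} (hp : Integrable g p) (hn : Integrable g n) (hq : Integrable g q)
    (hm : Integrable g m) :
    ∫ x, g x ∂p - ∫ x, g x ∂n = ∫ x, g x ∂q - ∫ x, g x ∂m := by
  -- Cross-adding turns the identity of signed measures into one of positive measures, where
  -- integrals add.
  have h' : p + m = q + n := by
    rw [← Measure.toSignedMeasure_eq_toSignedMeasure_iff, Measure.toSignedMeasure_add,
      Measure.toSignedMeasure_add]
    rwa [sub_eq_sub_iff_add_eq_add] at h
  rw [sub_eq_sub_iff_add_eq_add, ← integral_add_measure hp hm, ← integral_add_measure hq hn, h']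

/-- The images of the Jordan parts of `s` need not be compared with those of `t` one by one;
equality of the differences suffices for integrals. -/
theorem toSignedMeasure_map_sub {s t : SignedMeasure X} {c : X → X} (hc : Measurable c)
    (h : ∀ S, MeasurableSet S → s (c ⁻¹' S) = t S) :
    (s.toJordanDecomposition.posPart.map c).toSignedMeasure
      - (s.toJordanDecomposition.negPart.map c).toSignedMeasure
    = t.toJordanDecomposition.posPart.toSignedMeasure
      - t.toJordanDecomposition.negPart.toSignedMeasure := by
  ext S hS
  rw [Measure.toSignedMeasure_sub_apply hS, Measure.toSignedMeasure_sub_apply hS,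
    map_measureReal_apply hc hS, map_measureReal_apply hc hS,
    ← s.apply_eq_posPart_real_sub_negPart_real (hc hS),
    ← t.apply_eq_posPart_real_sub_negPart_real hS, h S hS]

theorem integral_sub_integral_comp {s t : SignedMeasure X} {c : X → X} (hc : Measurable c)
    (h : ∀ S, MeasurableSet S → s (c ⁻¹' S) = t S) {g : X → E} (hg : StronglyMeasurable g)
    (h1 : Integrable (fun x => g (c x)) s.toJordanDecomposition.posPart)
    (h2 : Integrable (fun x => g (c x)) s.toJordanDecomposition.negPart)
    (h3 : Integrable g t.toJordanDecomposition.posPart)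
    (h4 : Integrable g t.toJordanDecomposition.negPart) :
    ∫ x, g (c x) ∂s.toJordanDecomposition.posPart - ∫ x, g (c x) ∂s.toJordanDecomposition.negPart
    = ∫ x, g x ∂t.toJordanDecomposition.posPart - ∫ x, g x ∂t.toJordanDecomposition.negPart := by
  have e1 := integral_map (μ := s.toJordanDecomposition.posPart) hc.aemeasurable
    hg.aestronglyMeasurable
  have e2 := integral_map (μ := s.toJordanDecomposition.negPart) hc.aemeasurable
    hg.aestronglyMeasurable
  rw [← e1, ← e2]
  exact integral_sub_eq_of_toSignedMeasure_sub_eq (toSignedMeasure_map_sub hc h)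
    ((integrable_map_measure hg.aestronglyMeasurable hc.aemeasurable).2 h1)
    ((integrable_map_measure hg.aestronglyMeasurable hc.aemeasurable).2 h2) h3 h4

/-- Change of variables by a map under which the complex measure passes to its conjugate. -/
theorem cintegral_eq_conj {μ : ComplexMeasure X} {c : X → X} (hc : Measurable c)
    (h : ∀ S, MeasurableSet S → μ (c ⁻¹' S) = conj (μ S)) {g h' : X → ℂ}
    (hg : StronglyMeasurable g) (h1 : ∀ i, Integrable (fun x => g (c x)) (jordanPart μ i))
    (h2 : ∀ i, Integrable g (jordanPart μ i)) (hgc : ∀ x, g (c x) = conj (h' x)) :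
    cintegral μ g = conj (cintegral μ h') := by
  have hre := integral_sub_integral_comp (s := ComplexMeasure.re μ) (t := ComplexMeasure.re μ) hc
    (fun S hS => by
      change (μ (c ⁻¹' S)).re = (μ S).re
      rw [h S hS, Complex.conj_re]) hg (h1 0) (h1 1) (h2 0) (h2 1)
  -- Conjugation changes the sign of the imaginary part, so its positive and negative parts trade
  -- places.
  have him := integral_sub_integral_comp (s := ComplexMeasure.im μ)
    (t := -ComplexMeasure.im μ) hc
    (fun S hS => by
      change (μ (c ⁻¹' S)).im = -(μ S).im
      rw [h S hS, Complex.conj_im]) hg (h1 2) (h1 3)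
      (by rw [SignedMeasure.toJordanDecomposition_neg]; exact h2 3)
      (by rw [SignedMeasure.toJordanDecomposition_neg]; exact h2 2)
  rw [SignedMeasure.toJordanDecomposition_neg, JordanDecomposition.neg_posPart,
    JordanDecomposition.neg_negPart] at him
  simp only [hgc, integral_conj] at hre him
  simp only [cintegral, smul_eq_mul, map_add, map_sub, map_mul, Complex.conj_I]
  rw [hre, him]
  ring

end ComplexMeasure

/-! ### The geometry of sectors -/

theorem continuous_arg_sector {α : ℝ} : Continuous fun ξ : sector α => (ξ : ℂ).arg :=
  continuous_iff_continuousAt.2 fun ξ =>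
    (Complex.continuousAt_arg (Or.inl ξ.2.1)).comp continuous_subtype_val.continuousAt

/-- With `exists_exp_of_mem_sector`, this presents the sector as the exponential image of a strip,
so that rotations become vertical translations. -/
theorem exp_mem_sector {γ : ℝ} (hγ : γ ≤ Real.pi / 2) {w : ℂ} (hw : |w.im| < γ) :
    Complex.exp w ∈ sector γ := by
  have h := abs_lt.1 hw
  refine ⟨?_, ?_⟩
  · rw [Complex.exp_re]
    exact mul_pos (Real.exp_pos _) (Real.cos_pos_of_mem_Ioo ⟨by linarith, by linarith⟩)
  · rw [Complex.arg_exp, toIocMod_eq_self _ |>.2]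
    · exact hw
    · constructor <;> linarith [Real.pi_pos]

theorem ne_zero_of_mem_sector {γ : ℝ} {z : ℂ} (hz : z ∈ sector γ) : z ≠ 0 := by
  rintro rfl
  exact lt_irrefl _ hz.1

theorem exists_exp_of_mem_sector {γ : ℝ} {z : ℂ} (hz : z ∈ sector γ) :
    ∃ w : ℂ, |w.im| < γ ∧ Complex.exp w = z :=
  ⟨Complex.log z, by rw [Complex.log_im]; exact hz.2,
    Complex.exp_log (ne_zero_of_mem_sector hz)⟩

theorem mul_mem_sector {γ δ η : ℝ} (hη : η ≤ Real.pi / 2) (hadd : γ + δ ≤ η) {z w : ℂ}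
    (hz : z ∈ sector γ) (hw0 : w ≠ 0) (hw : |w.arg| ≤ δ) : z * w ∈ sector η := by
  have h : z * w = Complex.exp (Complex.log z + Complex.log w) := by
    rw [Complex.exp_add, Complex.exp_log (ne_zero_of_mem_sector hz), Complex.exp_log hw0]
  rw [h]
  apply exp_mem_sector hη
  rw [Complex.add_im, Complex.log_im, Complex.log_im]
  linarith [abs_add_le z.arg w.arg, hz.2]

theorem real_smul_mem_sector {γ r : ℝ} (hr : 0 < r) {z : ℂ} (hz : z ∈ sector γ) :
    (r : ℂ) * z ∈ sector γ := by
  refine ⟨?_, ?_⟩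
  · rw [Complex.re_ofReal_mul]
    exact mul_pos hr hz.1
  · rw [Complex.arg_real_mul _ hr]
    exact hz.2

/-- Outside the closed polar sector, a suitable `s` in the sector turns `ω` past the imaginary axis,
where the cosine is negative. -/
theorem abs_arg_le_of_forall_re_mul_nonneg {α : ℝ} (h0 : 0 < α) (hα : α ≤ Real.pi / 2) {ω : ℂ}
    (hω : ‖ω‖ = 1) (h : ∀ s ∈ sector α, 0 ≤ (ω * s).re) : |ω.arg| ≤ Real.pi / 2 - α := by
  have key : ∀ θ : ℝ, |θ| < α → 0 ≤ Real.cos (ω.arg + θ) := by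
    intro θ hθ
    have := h _ (exp_mem_sector hα (w := θ * Complex.I) (by simpa using hθ))
    rw [← Complex.norm_mul_exp_arg_mul_I ω, hω, Complex.ofReal_one, one_mul, ← Complex.exp_add,
      ← add_mul, ← Complex.ofReal_add, Complex.exp_ofReal_mul_I_re] at this
    exact this
  have hpi := Complex.arg_mem_Ioc ω
  rw [abs_le]
  constructor
  · by_contra! hc
    -- Such a `θ` puts `arg ω - θ` strictly between `-3π/2` and `-π/2`.
    obtain ⟨θ, h1, h2⟩ := exists_between
      (show max 0 (Real.pi / 2 + ω.arg) < α from max_lt h0 (by linarith))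
    have h3 := (max_lt_iff.1 h1)
    have := key (-θ) (by rw [abs_neg, abs_of_pos h3.1]; exact h2)
    have hneg := Real.cos_neg_of_pi_div_two_lt_of_lt (x := -(ω.arg + -θ)) (by linarith)
      (by linarith [hpi.1])
    rw [Real.cos_neg] at hneg
    linarith
  · by_contra! hc
    obtain ⟨θ, h1, h2⟩ := exists_between
      (show max 0 (Real.pi / 2 - ω.arg) < α from max_lt h0 (by linarith))
    have h3 := (max_lt_iff.1 h1)
    have := key θ (by rw [abs_of_pos h3.1]; exact h2)
    have hneg := Real.cos_neg_of_pi_div_two_lt_of_lt (x := ω.arg + θ) (by linarith)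
      (by linarith [hpi.2])
    linarith

/-! ### Laplace transforms of complex measures -/

section Laplace

variable {α : ℝ} {μ : ComplexMeasure (sector α)} {K : Set (sector α)}

theorem exists_compact_carrier (hμc : HasCompactSupp μ) {β : ℝ}
    (hμβ : CarriedBy μ {ξ | |(ξ : ℂ).arg| ≤ β}) :
    ∃ K : Set (sector α), IsCompact K ∧ (∀ ξ ∈ K, |(ξ : ℂ).arg| ≤ β) ∧
      ∀ i, jordanPart μ i Kᶜ = 0 := by
  obtain ⟨K, hK, hμK⟩ := hμc
  have hcl : IsClosed {ξ : sector α | |(ξ : ℂ).arg| ≤ β} :=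
    isClosed_le continuous_arg_sector.abs continuous_const
  refine ⟨K ∩ {ξ | |(ξ : ℂ).arg| ≤ β}, hK.inter_right hcl, fun ξ hξ => hξ.2, fun i => ?_⟩
  rw [Set.compl_inter]
  exact measure_union_null (hμK.jordanPart_compl hK.isClosed.measurableSet i)
    (hμβ.jordanPart_compl hcl.measurableSet i)

theorem integral_exp_differentiable (hK : IsCompact K) {p : Measure (sector α)}
    [IsFiniteMeasure p] (hp : p Kᶜ = 0) :
    Differentiable ℂ fun z : ℂ => ∫ ξ, Complex.exp (-z * (ξ : ℂ)) ∂p := by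
  intro z₀
  obtain ⟨R, hR⟩ := (hK.image continuous_subtype_val).isBounded.exists_norm_le
  have hae : ∀ᵐ ξ : sector α ∂p, ‖(ξ : ℂ)‖ ≤ R := by
    have : ∀ᵐ ξ : sector α ∂p, ξ ∈ K := by rw [ae_iff]; exact hp
    filter_upwards [this] with ξ hξ
    exact hR _ (Set.mem_image_of_mem _ hξ)
  have hint : ∀ z : ℂ, Integrable (fun ξ : sector α => Complex.exp (-z * (ξ : ℂ))) p := fun z =>
    integrable_of_continuousOn_isCompact hK hK.isClosed.measurableSet hp
      (Continuous.continuousOn (by fun_prop))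
  refine (hasDerivAt_integral_of_dominated_loc_of_deriv_le (𝕜 := ℂ)
    (F' := fun z (ξ : sector α) => Complex.exp (-z * (ξ : ℂ)) * (-1 * (ξ : ℂ)))
    -- On the unit ball about `z₀` one has `|z| ≤ ‖z₀‖ + 1`, and `|ξ| ≤ R` on `K`.
    (bound := fun _ => Real.exp ((‖z₀‖ + 1) * R) * R)
    (Metric.ball_mem_nhds z₀ one_pos) (Filter.Eventually.of_forall fun z => ?_) (hint z₀) ?_ ?_
    (integrable_const _) ?_).2.differentiableAt
  · exact (hint z).aestronglyMeasurable
  · exact Continuous.aestronglyMeasurable (by fun_prop)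
  · filter_upwards [hae] with ξ hξ z hz
    have hz' : ‖z‖ ≤ ‖z₀‖ + 1 := by
      have := norm_sub_norm_le z z₀
      rw [Metric.mem_ball, dist_eq_norm] at hz
      linarith
    rw [norm_mul, Complex.norm_exp, neg_one_mul, norm_neg]
    gcongr
    refine (Complex.re_le_norm _).trans ?_
    rw [norm_mul, norm_neg]
    gcongr
  · refine Filter.Eventually.of_forall fun ξ z _ => ?_
    exact (((hasDerivAt_id z).fun_neg).mul_const (ξ : ℂ)).cexp

theorem cintegral_exp_differentiable (hK : IsCompact K) (hp : ∀ i, jordanPart μ i Kᶜ = 0) :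
    Differentiable ℂ fun z : ℂ => cintegral μ fun ξ => Complex.exp (-z * (ξ : ℂ)) := by
  simp only [cintegral_eq_sum]
  exact Differentiable.fun_sum fun i _ =>
    (integral_exp_differentiable hK (hp i)).const_smul (jordanCoeff i)

theorem sectorConj_involutive : Function.Involutive (sectorConj α) := fun _ =>
  Subtype.ext (Complex.conj_conj _)

theorem continuous_sectorConj : Continuous (sectorConj α) :=
  Continuous.subtype_mk (Complex.continuous_conj.comp continuous_subtype_val) _

theorem conj_cintegral (hK : IsCompact K) (hp : ∀ i, jordanPart μ i Kᶜ = 0)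
    (hμs : IsSymmetricMeasure μ) {g h : C(sector α, ℂ)}
    (hgh : ∀ ξ, g (sectorConj α ξ) = conj (h ξ)) :
    cintegral μ g = conj (cintegral μ h) := by
  refine cintegral_eq_conj continuous_sectorConj.measurable (fun S hS => ?_)
    g.continuous.stronglyMeasurable (fun i => ?_) (fun i => ?_) hgh
  · rw [← hμs S hS, sectorConj_involutive.image_eq_preimage_symm]
  · exact integrable_of_continuousOn_isCompact hK hK.isClosed.measurableSet (hp i)
      (g.continuous.comp continuous_sectorConj).continuousOn
  · exact integrable_of_continuousOn_isCompact hK hK.isClosed.measurableSet (hp i)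
      g.continuous.continuousOn

theorem cintegral_exp_conj (hK : IsCompact K) (hp : ∀ i, jordanPart μ i Kᶜ = 0)
    (hμs : IsSymmetricMeasure μ) (z : ℂ) :
    cintegral μ (fun ξ => Complex.exp (-(conj z) * (ξ : ℂ)))
      = conj (cintegral μ fun ξ => Complex.exp (-z * (ξ : ℂ))) := by
  refine conj_cintegral hK hp hμs (g := ⟨fun ξ => Complex.exp (-(conj z) * (ξ : ℂ)), by fun_prop⟩)
    (h := ⟨fun ξ => Complex.exp (-z * (ξ : ℂ)), by fun_prop⟩) fun ξ => ?_
  simp [sectorConj, ← Complex.exp_conj]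

/-- The Laplace transform of a compactly carried measure is bounded on the polar sector. -/
theorem exists_norm_cintegral_exp_le :
    ∃ C : ℝ, ∀ w : ℂ, |w.im| ≤ Real.pi / 2 - α →
      ‖cintegral μ fun ξ : sector α => Complex.exp (-(Complex.exp w) * (ξ : ℂ))‖ ≤ C := by
  refine ⟨∑ i, 1 * (jordanPart μ i).real Set.univ, fun w hw => norm_cintegral_le fun ξ => ?_⟩
  obtain ⟨v, hv, hξ⟩ := exists_exp_of_mem_sector ξ.2
  rw [Complex.norm_exp, ← hξ, neg_mul, ← Complex.exp_add, Complex.neg_re, Real.exp_le_one_iff,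
    neg_nonpos]
  -- The two arguments add up to less than `π/2`, so every exponential in the integrand has modulus
  -- at most 1.
  refine (exp_mem_sector le_rfl ?_).1.le
  rw [Complex.add_im]
  linarith [abs_add_le w.im v.im]

end Laplace

/-! ### A Phragmén-Lindelöf argument -/

/-- Symmetry doubles the hypothesis to the strips of half-width `γ` about `Im = ψ` and `Im = -ψ`.
Points with `|ψ| ≤ |Im w| < γ` lie in one of them; the remaining points lie between the lines `Im =
±ψ`, where `g` is bounded by `C` and the maximum principle for a strip applies. -/
theorem norm_le_of_norm_le_rotated {g : ℂ → ℂ} (hg : Differentiable ℂ g)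
    (hconj : ∀ w, ‖g (conj w)‖ = ‖g w‖) {ψ C m γ : ℝ}
    (hC : ∀ w : ℂ, |w.im| ≤ |ψ| → ‖g w‖ ≤ C) (hγ : 0 < γ)
    (hm : ∀ w : ℂ, |w.im| < γ → ‖g (w + ψ * Complex.I)‖ ≤ m) :
    ∀ w : ℂ, |w.im| < γ → ‖g w‖ ≤ m := by
  have h1 : ∀ w : ℂ, |w.im - ψ| < γ → ‖g w‖ ≤ m := by
    intro w hw
    have := hm (w - ψ * Complex.I) (by simpa using hw)
    rwa [sub_add_cancel] at this
  have h2 : ∀ w : ℂ, |w.im + ψ| < γ → ‖g w‖ ≤ m := by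
    intro w hw
    rw [← hconj]
    apply h1
    rwa [Complex.conj_im, ← neg_add', abs_neg]
  intro w hw
  rcases le_or_gt |ψ| |w.im| with h | h
  · rcases le_total 0 ψ with h3 | h3 <;> rcases le_total 0 w.im with h4 | h4 <;>
      simp only [abs_of_nonneg, abs_of_nonpos, h3, h4] at h hw
    · exact h1 w (abs_lt.2 ⟨by linarith, by linarith⟩)
    · exact h2 w (abs_lt.2 ⟨by linarith, by linarith⟩)
    · exact h2 w (abs_lt.2 ⟨by linarith, by linarith⟩)
    · exact h1 w (abs_lt.2 ⟨by linarith, by linarith⟩)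
  · have hψ0 : 0 < |ψ| := (abs_nonneg _).trans_lt h
    have hb : ∀ w : ℂ, |w.im| = |ψ| → ‖g w‖ ≤ m := by
      intro w hw
      rcases abs_eq_abs.1 hw with h | h
      · exact h1 w (by simpa [h] using hγ)
      · exact h2 w (by simpa [h] using hγ)
    refine PhragmenLindelof.horizontal_strip (a := -|ψ|) (b := |ψ|) hg.diffContOnCl
      -- Boundedness by `C` is the growth condition with both exponents 0.
      ⟨0, div_pos Real.pi_pos (by linarith), 0, ?_⟩ (fun z hz => hb z (by rw [hz, abs_neg, abs_abs]))
      (fun z hz => hb z (by rw [hz, abs_abs])) (abs_le.1 h.le).1 (abs_le.1 h.le).2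
    refine Asymptotics.IsBigO.of_bound C ?_
    refine Filter.Eventually.filter_mono inf_le_right ?_
    rw [Filter.eventually_principal]
    intro z hz
    simpa using hC z (abs_le.2 ⟨hz.1.le, hz.2.le⟩)

/-! ### Multiplicative functions on the sector -/

section Sector

variable {α : ℝ}

/-- Follows from `Re z sin α ∓ Im z cos α = |z| sin (α ∓ arg z)`. As an intersection of open
half-planes, the sector is open and closed under addition. -/
theorem mem_sector_iff (h0 : 0 < α) (hα : α ≤ Real.pi / 2) {z : ℂ} :
    z ∈ sector α ↔ 0 < z.re ∧ z.im * Real.cos α < z.re * Real.sin α ∧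
      -z.im * Real.cos α < z.re * Real.sin α := by
  refine and_congr_right fun hz => ?_
  have hz0 : 0 < ‖z‖ := by
    rw [norm_pos_iff]
    rintro rfl
    exact lt_irrefl _ hz
  obtain ⟨h1, h2⟩ := abs_lt.1 (Complex.abs_arg_lt_pi_div_two_iff.2 (Or.inl hz))
  have key : ∀ θ, -(Real.pi / 2) < θ → θ < Real.pi / 2 → (θ < α ↔ 0 < Real.sin (α - θ)) := by
    intro θ h1 h2
    constructor
    · intro h
      exact Real.sin_pos_of_pos_of_lt_pi (by linarith) (by linarith)
    · intro h
      by_contra! hc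
      exact absurd h (not_lt.2 (Real.sin_nonpos_of_nonpos_of_neg_pi_le (by linarith)
        (by linarith [Real.pi_pos])))
  have e1 : z.re * Real.sin α - z.im * Real.cos α = ‖z‖ * Real.sin (α - z.arg) := by
    rw [Real.sin_sub, ← Complex.norm_mul_cos_arg z, ← Complex.norm_mul_sin_arg z]
    ring
  have e2 : z.re * Real.sin α - -z.im * Real.cos α = ‖z‖ * Real.sin (α - -z.arg) := by
    rw [Real.sin_sub, Real.cos_neg, Real.sin_neg, ← Complex.norm_mul_cos_arg z,
      ← Complex.norm_mul_sin_arg z]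
    ring
  rw [abs_lt, and_comm, key _ h1 h2, neg_lt, key (-z.arg) (by linarith) (by linarith),
    ← sub_pos (a := z.re * Real.sin α), ← sub_pos (a := z.re * Real.sin α), e1, e2,
    mul_pos_iff_of_pos_left hz0, mul_pos_iff_of_pos_left hz0]

theorem add_mem_sector (h0 : 0 < α) (hα : α ≤ Real.pi / 2) {z w : ℂ} (hz : z ∈ sector α)
    (hw : w ∈ sector α) : z + w ∈ sector α := by
  rw [mem_sector_iff h0 hα] at *
  simp only [Complex.add_re, Complex.add_im]
  refine ⟨?_, ?_, ?_⟩ <;> linarith [hz.1, hw.1, hz.2.1, hw.2.1, hz.2.2, hw.2.2]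

theorem isOpen_sector (h0 : 0 < α) (hα : α ≤ Real.pi / 2) : IsOpen (sector α) := by
  have : sector α = {z : ℂ | 0 < z.re ∧ z.im * Real.cos α < z.re * Real.sin α ∧
      -z.im * Real.cos α < z.re * Real.sin α} := Set.ext fun z => mem_sector_iff h0 hα
  rw [this]
  refine IsOpen.and ?_ (IsOpen.and ?_ ?_) <;>
    exact isOpen_lt (by fun_prop) (by fun_prop)

theorem isPreconnected_sector (hα : α ≤ Real.pi / 2) : IsPreconnected (sector α) := by
  have : sector α = Complex.exp '' (Complex.im ⁻¹' Set.Ioo (-α) α) := by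
    ext z
    constructor
    · intro hz
      obtain ⟨w, hw, h⟩ := exists_exp_of_mem_sector hz
      exact ⟨w, abs_lt.1 hw, h⟩
    · rintro ⟨w, hw, rfl⟩
      exact exp_mem_sector hα (abs_lt.2 hw)
  rw [this]
  refine IsPreconnected.image ?_ _ Complex.continuous_exp.continuousOn
  exact ((convex_Ioo (-α) α).linear_preimage Complex.imLm).isPreconnected

/-- A zero at `t` spreads to the open set `t + S_α`, hence everywhere by the identity theorem.
Without zeros, differentiating the functional equation gives `h' = c h`. -/
theorem eq_zero_or_exists_eq_exp (h0 : 0 < α) (hα : α ≤ Real.pi / 2) {h : ℂ → ℂ}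
    (hd : DifferentiableOn ℂ h (sector α))
    (hmul : ∀ s ∈ sector α, ∀ t ∈ sector α, h (s + t) = h s * h t) :
    (∀ t ∈ sector α, h t = 0) ∨ ∃ c : ℂ, ∀ t ∈ sector α, h t = Complex.exp (c * t) := by
  have hopen := isOpen_sector h0 hα
  by_cases hz : ∃ t ∈ sector α, h t = 0
  · left
    obtain ⟨t, ht, h1⟩ := hz
    refine (hd.analyticOnNhd hopen).eqOn_zero_of_preconnected_of_eventuallyEq_zero
      (isPreconnected_sector hα) (add_mem_sector h0 hα ht ht) ?_
    -- The factorization `h s = h (s - t) * h t` needs `s - t` in the sector, hence the base point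
    -- `2t` instead of `t`.
    have hev : ∀ᶠ s in nhds (t + t), s - t ∈ sector α :=
      (continuous_id.sub continuous_const).continuousAt.eventually
        (hopen.mem_nhds (by simpa using ht))
    filter_upwards [hev] with s hs
    rw [← sub_add_cancel s t, hmul _ hs _ ht, h1, mul_zero, Pi.zero_apply]
  · right
    push Not at hz
    have hda : ∀ t ∈ sector α, HasDerivAt h (deriv h t) t := fun t ht =>
      (hd.differentiableAt (hopen.mem_nhds ht)).hasDerivAt
    have hder : ∀ s ∈ sector α, ∀ t ∈ sector α, deriv h (s + t) = deriv h s * h t := by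
      intro s hs t ht
      have h1 := (hda _ (add_mem_sector h0 hα hs ht)).comp_add_const s t
      have h2 := (hda s hs).mul_const (h t)
      refine h1.unique (h2.congr_of_eventuallyEq ?_)
      filter_upwards [hopen.mem_nhds hs] with x hx
      exact hmul x hx t ht
    have h1 : (1 : ℂ) ∈ sector α := ⟨by simp, by simpa using h0⟩
    set c := deriv h 1 / h 1 with hc
    have hdc : ∀ t ∈ sector α, deriv h t = c * h t := by
      intro t ht
      -- The derivative at `t + 1` is computed in two ways, as `h' t * h 1` and as `h' 1 * h t`.
      rw [hc, div_mul_eq_mul_div, eq_div_iff (hz 1 h1), ← hder t ht 1 h1, add_comm, hder 1 h1 t ht]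
    have hconst : ∃ a, ∀ t ∈ sector α, h t * Complex.exp (-c * t) = a := by
      refine hopen.exists_is_const_of_deriv_eq_zero (isPreconnected_sector hα)
        (f := fun t => h t * Complex.exp (-c * t)) (hd.mul (by fun_prop)) fun t ht => ?_
      have := (hda t ht).mul ((((hasDerivAt_id t).const_mul (-c))).cexp)
      simp only [id, mul_one] at this
      rw [hdc t ht] at this
      refine this.deriv.trans ?_
      rw [Pi.zero_apply]
      ring
    obtain ⟨a, ha⟩ := hconst
    have hexp : ∀ t ∈ sector α, h t = a * Complex.exp (c * t) := by
      intro t ht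
      rw [← ha t ht, mul_assoc, ← Complex.exp_add]
      simp
    have ha1 : a = 1 := by
      have := hmul 1 h1 1 h1
      rw [hexp _ (add_mem_sector h0 hα h1 h1), hexp 1 h1, mul_add, Complex.exp_add] at this
      have ha0 : a ≠ 0 := by
        rintro rfl
        exact hz 1 h1 (by rw [hexp 1 h1, zero_mul])
      have he := Complex.exp_ne_zero (c * 1)
      have h3 : a * (Complex.exp (c * 1) * Complex.exp (c * 1)) * a
          = a * (Complex.exp (c * 1) * Complex.exp (c * 1)) * 1 := by
        linear_combination -this
      exact mul_left_cancel₀ (mul_ne_zero ha0 (mul_ne_zero he he)) h3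
    exact ⟨c, fun t ht => by rw [hexp t ht, ha1, one_mul]⟩

end Sector

/-! ### Characters -/

section Character

/-- The ℓ¹ norm makes the unitization a Banach algebra whose unit has norm 1, so characters are
contractive. -/
theorem norm_algHom_unitization_le {C : Type*} [NonUnitalNormedCommRing C] [NormedSpace ℂ C]
    [IsScalarTower ℂ C C] [SMulCommClass ℂ C C] [CompleteSpace C]
    (f : Unitization ℂ C →ₐ[ℂ] ℂ) (x : WithLp 1 (Unitization ℂ C)) :
    ‖f (WithLp.ofLp x)‖ ≤ ‖x‖ := by
  have h := AlgHom.norm_apply_le_self_mul_norm_one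
    (f.comp (WithLp.unitizationAlgEquiv (𝕜 := ℂ) (A := C) ℂ).toAlgHom) x
  have h1 : ‖(1 : WithLp 1 (Unitization ℂ C))‖ = 1 := by
    rw [WithLp.unitization_norm_def]
    change ‖(1 : Unitization ℂ C).fst‖ + ‖(1 : Unitization ℂ C).snd‖ = 1
    simp
  rw [h1, mul_one] at h
  exact h

/-- The continuous linear functional on a commutative Banach algebra that is given by a character
of the unitization. -/
def charCLM {C : Type*} [NonUnitalNormedCommRing C] [NormedSpace ℂ C]
    [IsScalarTower ℂ C C] [SMulCommClass ℂ C C] [CompleteSpace C]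
    (f : Unitization ℂ C →ₐ[ℂ] ℂ) : C →L[ℂ] ℂ :=
  LinearMap.mkContinuous
    { toFun := fun a => f (a : Unitization ℂ C)
      map_add' := fun a b => by rw [Unitization.inr_add, map_add]
      map_smul' := fun c a => by rw [Unitization.inr_smul, map_smul, RingHom.id_apply] } 1
    fun a => by
      have := norm_algHom_unitization_le f (WithLp.toLp 1 (a : Unitization ℂ C))
      rwa [WithLp.unitization_norm_inr, ← one_mul ‖a‖] at this

theorem charCLM_apply {C : Type*} [NonUnitalNormedCommRing C] [NormedSpace ℂ C]
    [IsScalarTower ℂ C C] [SMulCommClass ℂ C C] [CompleteSpace C]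
    (f : Unitization ℂ C →ₐ[ℂ] ℂ) (a : C) : charCLM f a = f (a : Unitization ℂ C) := rfl

theorem charCLM_mul {C : Type*} [NonUnitalNormedCommRing C] [NormedSpace ℂ C]
    [IsScalarTower ℂ C C] [SMulCommClass ℂ C C] [CompleteSpace C]
    (f : Unitization ℂ C →ₐ[ℂ] ℂ) (a b : C) : charCLM f (a * b) = charCLM f a * charCLM f b := by
  rw [charCLM_apply, Unitization.inr_mul, map_mul]; rfl

theorem rho_eq_spectralRadius {B : Type*} [NonUnitalNormedRing B] [NormedSpace ℂ B]
    [IsScalarTower ℂ B B] [SMulCommClass ℂ B B] (b : B) :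
    rho b = spectralRadius ℂ (WithLp.toLp 1 (b : Unitization ℂ B)) := by
  rw [rho, Unitization.quasispectrum_eq_spectrum_inr, spectralRadius,
    ← AlgEquiv.spectrum_eq (WithLp.unitizationAlgEquiv (𝕜 := ℂ) (A := B) ℂ)]
  rfl

/-- A functional that is multiplicative on the powers of an element is bounded there by the
spectral radius. -/
theorem nnnorm_le_rho_of_forall_pow {B : Type*} [NonUnitalNormedRing B] [NormedSpace ℂ B]
    [IsScalarTower ℂ B B] [SMulCommClass ℂ B B] [CompleteSpace B] (b : B) (z : ℂ)
    (h : ∀ n : ℕ, ‖z‖₊ ^ n ≤ ‖(WithLp.toLp 1 (b : Unitization ℂ B)) ^ n‖₊) :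
    (‖z‖₊ : ℝ≥0∞) ≤ rho b := by
  rw [rho_eq_spectralRadius]
  refine ge_of_tendsto (spectrum.pow_nnnorm_pow_one_div_tendsto_nhds_spectralRadius _) ?_
  filter_upwards [Filter.eventually_gt_atTop 0] with n hn
  have hn' : (n : ℝ) ≠ 0 := by positivity
  calc (‖z‖₊ : ℝ≥0∞) = ((‖z‖₊ : ℝ≥0∞) ^ n) ^ (1 / n : ℝ) := by
        rw [← ENNReal.rpow_natCast, ← ENNReal.rpow_mul, mul_one_div_cancel hn', ENNReal.rpow_one]
    _ ≤ _ := by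
        refine ENNReal.rpow_le_rpow ?_ (by positivity)
        exact_mod_cast h n

end Character

/-! ### Characters of the algebra generated by the semigroup. -/

namespace AnalyticSemigroup

variable {α : ℝ} {B : Type*} [NonUnitalNormedRing B] [NormedSpace ℂ B] [IsScalarTower ℂ B B]
  [SMulCommClass ℂ B B] [CompleteSpace B] (T : AnalyticSemigroup α B)

/-- The inclusion of the algebra of the semigroup. -/
def inclusion : T.algebra →L[ℂ] B :=
  LinearMap.mkContinuous
    { toFun := fun a => (a : B)
      map_add' := fun _ _ => rfl
      map_smul' := fun _ _ => rfl } 1 fun a => (one_mul ‖(a : B)‖).ge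

/-- The spectral radius is taken in `B`, to which the character need not extend multiplicatively.
But the unitizations embed isometrically, so `|f a| ^ n ≤ ‖a ^ n‖` may be read in `B`, and Gelfand's
formula concludes. -/
theorem nnnorm_char_le_rho (f : Unitization ℂ T.algebra →ₐ[ℂ] ℂ) (a : T.algebra) :
    (‖f (a : Unitization ℂ T.algebra)‖₊ : ℝ≥0∞) ≤ rho (a : B) := by
  refine nnnorm_le_rho_of_forall_pow _ _ fun n => ?_
  let j : Unitization ℂ T.algebra →ₐ[ℂ] Unitization ℂ B :=
    Unitization.lift
      ((Unitization.inrNonUnitalAlgHom ℂ B).comp (NonUnitalSubalgebraClass.subtype T.algebra))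
  have hj : ∀ x : Unitization ℂ T.algebra, ‖WithLp.toLp 1 (j x)‖ = ‖WithLp.toLp 1 x‖ := by
    intro x
    rw [WithLp.unitization_norm_def, WithLp.unitization_norm_def]
    simp [j, Unitization.algebraMap_eq_inl]
    rfl
  have h1 := norm_algHom_unitization_le f (WithLp.toLp 1 ((a : Unitization ℂ T.algebra) ^ n))
  rw [← hj, map_pow, map_pow] at h1
  have h2 : j (a : Unitization ℂ T.algebra) = ((a : B) : Unitization ℂ B) := by
    simp [j]
  rw [h2, norm_pow] at h1
  exact h1

/-- Hahn-Banach: `T` is differentiable as a map into `B`, so a functional on `B` is what makes `t ↦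
f (T(t))` holomorphic. -/
theorem exists_dual_extension (f : Unitization ℂ T.algebra →ₐ[ℂ] ℂ) :
    ∃ F : StrongDual ℂ B, ∀ a : T.algebra, F a = f (a : Unitization ℂ T.algebra) := by
  let g : StrongDual ℂ T.algebra.toSubmodule := LinearMap.mkContinuous
    { toFun := fun a => charCLM f ⟨a.1, a.2⟩
      map_add' := fun a b => _root_.map_add (charCLM f) ⟨a.1, a.2⟩ ⟨b.1, b.2⟩
      map_smul' := fun c a => map_smul (charCLM f) c ⟨a.1, a.2⟩ } ‖charCLM f‖
    fun a => (charCLM f).le_opNorm _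
  obtain ⟨F, hF, -⟩ := exists_extension_norm_eq T.algebra.toSubmodule g
  exact ⟨F, fun a => hF ⟨a.1, a.2⟩⟩

/-- A character either vanishes on the algebra of the semigroup or is exponential on the
semigroup. -/
theorem char_eq_zero_or_exp (h0 : 0 < α) (hα : α ≤ Real.pi / 2)
    (f : Unitization ℂ T.algebra →ₐ[ℂ] ℂ) :
    (∀ a : T.algebra, f (a : Unitization ℂ T.algebra) = 0) ∨
      ∃ c : ℂ, ∀ t : sector α, f (T.elem t : Unitization ℂ T.algebra) = Complex.exp (c * t) := by
  obtain ⟨F, hF⟩ := T.exists_dual_extension f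
  have hT : ∀ t (ht : t ∈ sector α), F (T.toFun t) = f (T.elem ⟨t, ht⟩ : Unitization ℂ T.algebra) :=
    fun t ht => hF (T.elem ⟨t, ht⟩)
  have hmul : ∀ x ∈ T.algebra, ∀ y ∈ T.algebra, F (x * y) = F x * F y := by
    intro x hx y hy
    have h1 := hF (⟨x, hx⟩ * ⟨y, hy⟩)
    rw [Unitization.inr_mul, map_mul, ← hF, ← hF] at h1
    exact h1
  rcases eq_zero_or_exists_eq_exp h0 hα (h := fun t => F (T.toFun t))
    (F.differentiable.comp_differentiableOn T.differentiableOn) (fun s hs t ht => by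
      rw [T.map_add s hs t ht, hmul _ (T.mem_algebra ⟨s, hs⟩) _ (T.mem_algebra ⟨t, ht⟩)])
    with h | ⟨c, hc⟩
  · left
    intro a
    rw [← hF]
    have hcl : IsClosed {x : B | F x = 0} := isClosed_eq F.continuous continuous_const
    refine closure_minimal (s := (NonUnitalAlgebra.adjoin ℂ (T.toFun '' sector α) : Set B)) ?_ hcl
      a.2
    intro x hx
    change F x = 0
    induction hx using NonUnitalAlgebra.adjoin_induction with
    | mem x hx =>
      obtain ⟨t, ht, rfl⟩ := hx
      exact h t ht
    | add x y _ _ hx hy => rw [_root_.map_add, hx, hy, add_zero]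
    | zero => exact map_zero F
    | mul x y hx' hy' hx hy =>
      rw [hmul x (NonUnitalSubalgebra.le_topologicalClosure _ hx') y
        (NonUnitalSubalgebra.le_topologicalClosure _ hy'), hx, zero_mul]
    | smul c x _ hx => rw [map_smul, hx, smul_zero]
  · right
    exact ⟨c, fun t => by rw [← hc t t.2, hT t t.2]⟩

/-- The characters take the functional calculus to the Laplace transform of the measure. -/
theorem nnnorm_cintegral_exp_le_rho_calculus {β : ℝ} (hα : α ≤ Real.pi / 2)
    {μ : ComplexMeasure (sector α)} {K : Set (sector α)} (hK : IsCompact K)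
    (hKβ : ∀ ξ ∈ K, |(ξ : ℂ).arg| ≤ β) (hp : ∀ i, jordanPart μ i Kᶜ = 0)
    {f : Unitization ℂ T.algebra →ₐ[ℂ] ℂ} {c : ℂ}
    (hc : ∀ t : sector α, f (T.elem t : Unitization ℂ T.algebra) = Complex.exp (c * t))
    {t : ℂ} (ht : t ∈ sector (α - β)) :
    (‖cintegral μ fun ξ : sector α => Complex.exp (c * t * (ξ : ℂ))‖₊ : ℝ≥0∞)
      ≤ rho (T.calculus μ t) := by
  classical
  have hmem : ∀ ξ ∈ K, t * (ξ : ℂ) ∈ sector α := fun ξ hξ =>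
    mul_mem_sector hα (by linarith) ht (ne_zero_of_mem_sector ξ.2) (hKβ ξ hξ)
  have hae : ∀ i, ∀ᵐ ξ ∂(jordanPart μ i), ξ ∈ K := fun i => by rw [ae_iff]; exact hp i
  -- The integrand is lifted to the subalgebra, where characters act. Off `K` the point `t * ξ` may
  -- leave the sector; the default 0 there is seen by no Jordan part.
  let g : sector α → T.algebra := fun ξ =>
    if h : t * (ξ : ℂ) ∈ sector α then T.elem ⟨t * (ξ : ℂ), h⟩ else 0
  have hg : ∀ ξ (hξ : ξ ∈ K), g ξ = T.elem ⟨t * (ξ : ℂ), hmem ξ hξ⟩ := fun ξ hξ =>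
    dif_pos (hmem ξ hξ)
  have hcont : ContinuousOn g K := by
    rw [Topology.IsInducing.subtypeVal.continuousOn_iff]
    refine ContinuousOn.congr (f := fun ξ : sector α => T.toFun (t * (ξ : ℂ))) ?_ fun ξ hξ => by
      rw [Function.comp_apply, hg ξ hξ]; rfl
    exact T.differentiableOn.continuousOn.comp (by fun_prop) hmem
  have hint : ∀ i, Integrable g (jordanPart μ i) := fun i =>
    integrable_of_continuousOn_isCompact hK hK.isClosed.measurableSet (hp i) hcont
  have h1 : T.calculus μ t = (cintegral μ g : T.algebra) := by
    have := ContinuousLinearMap.cintegral_comp_comm T.inclusion hint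
    refine Eq.trans (cintegral_congr fun i => ?_) this
    filter_upwards [hae i] with ξ hξ
    rw [hg ξ hξ]; rfl
  have h2 : cintegral μ (fun ξ : sector α => Complex.exp (c * t * (ξ : ℂ)))
      = f ((cintegral μ g : T.algebra) : Unitization ℂ T.algebra) := by
    have := ContinuousLinearMap.cintegral_comp_comm (charCLM f) hint
    refine Eq.trans (cintegral_congr fun i => ?_) this
    filter_upwards [hae i] with ξ hξ
    rw [hg ξ hξ, charCLM_apply, hc, mul_assoc]
  rw [h1, h2]
  exact T.nnnorm_char_le_rho f _

end AnalyticSemigroup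

/-! ### A holomorphic functional calculus modulo the radical -/

section FunctionalCalculus

theorem ContinuousLinearMap.circleIntegral_comp_comm {E F : Type*} [NormedAddCommGroup E]
    [NormedSpace ℂ E] [CompleteSpace E] [NormedAddCommGroup F] [NormedSpace ℂ F] [CompleteSpace F]
    (L : E →L[ℂ] F) {g : ℂ → E} {c : ℂ} {R : ℝ} (hg : CircleIntegrable g c R) :
    (∮ z in C(c, R), L (g z)) = L (∮ z in C(c, R), g z) := by
  simp only [circleIntegral]
  rw [← L.intervalIntegral_comp_comm hg.out]
  simp

variable {C : Type*} [NonUnitalNormedCommRing C] [NormedSpace ℂ C]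
    [IsScalarTower ℂ C C] [SMulCommClass ℂ C C] [CompleteSpace C]

/-- If the spectrum of `a` is contained in a disc together with the point `0` outside of the disc,
then there is an element whose Gelfand transform is that of `g a` where the Gelfand transform of
`a` does not vanish, and zero elsewhere. -/
theorem exists_forall_char_eq {c : ℂ} {R : ℝ} (hR : 0 < R) (h0 : (0 : ℂ) ∉ Metric.closedBall c R)
    {g : ℂ → ℂ} (hg : DifferentiableOn ℂ g (Metric.closedBall c R)) (a : C)
    (ha : ∀ f : Unitization ℂ C →ₐ[ℂ] ℂ, f (a : Unitization ℂ C) = 0 ∨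
      f (a : Unitization ℂ C) ∈ Metric.ball c R) :
    ∃ v : C, ∀ f : Unitization ℂ C →ₐ[ℂ] ℂ,
      (f (a : Unitization ℂ C) = 0 → f (v : Unitization ℂ C) = 0) ∧
      (f (a : Unitization ℂ C) ≠ 0 → f (v : Unitization ℂ C) = g (f (a : Unitization ℂ C))) := by
  let W := WithLp 1 (Unitization ℂ C)
  let _ : NormedCommRing (WithLp 1 (Unitization ℂ C)) :=
    { WithLp.instUnitizationNormedRing (𝕜 := ℂ) (A := C) with
      mul_comm := fun x y => by
        apply (WithLp.unitizationAlgEquiv (𝕜 := ℂ) (A := C) ℂ).injective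
        rw [map_mul, map_mul, mul_comm] }
  let x : W := WithLp.toLp 1 (a : Unitization ℂ C)
  have hsphere : ∀ z ∈ Metric.sphere c R, z ∈ resolventSet ℂ x := by
    intro z hz
    by_contra hs
    obtain ⟨f, hf⟩ := WeakDual.CharacterSpace.mem_spectrum_iff_exists.1
      (show z ∈ spectrum ℂ x from hs)
    have h := ha ((WeakDual.CharacterSpace.toAlgHom f).comp
      (WithLp.unitizationAlgEquiv (𝕜 := ℂ) (A := C) ℂ).symm.toAlgHom)
    have hfz : ((WeakDual.CharacterSpace.toAlgHom f).comp
      (WithLp.unitizationAlgEquiv (𝕜 := ℂ) (A := C) ℂ).symm.toAlgHom) (a : Unitization ℂ C) = z :=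
      hf
    rw [hfz] at h
    rcases h with rfl | h
    · exact h0 (Metric.sphere_subset_closedBall hz)
    · rw [Metric.mem_ball] at h
      rw [Metric.mem_sphere] at hz
      exact h.ne hz
  have hcont : ContinuousOn (fun z => g z • resolvent x z) (Metric.sphere c R) := by
    refine (hg.continuousOn.mono Metric.sphere_subset_closedBall).smul fun z hz => ?_
    exact (spectrum.hasDerivAt_resolvent_const_left (hsphere z hz)).continuousAt.continuousWithinAt
  -- The Riesz-Dunford integral around the part of the spectrum inside the disc.
  let V : W := (2 * Real.pi * Complex.I : ℂ)⁻¹ • ∮ z in C(c, R), g z • resolvent x z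
  have hchar : ∀ f : Unitization ℂ C →ₐ[ℂ] ℂ, f (WithLp.ofLp V) =
      (2 * Real.pi * Complex.I : ℂ)⁻¹ •
        ∮ z in C(c, R), (z - f (a : Unitization ℂ C))⁻¹ • g z := by
    intro f
    let f' : W →ₐ[ℂ] ℂ := f.comp (WithLp.unitizationAlgEquiv (𝕜 := ℂ) (A := C) ℂ).toAlgHom
    let L : W →L[ℂ] ℂ := ⟨f'.toLinearMap, map_continuous f'⟩
    have h1 : f (WithLp.ofLp V) = L V := rfl
    rw [h1, map_smul, ← L.circleIntegral_comp_comm (hcont.circleIntegrable hR.le)]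
    congr 1
    refine circleIntegral.integral_congr hR.le fun z hz => ?_
    have h2 : f' (resolvent x z) * (z - f (a : Unitization ℂ C)) = 1 := by
      have h3 : resolvent x z * (algebraMap ℂ W z - x) = 1 :=
        Ring.inverse_mul_cancel _ (hsphere z hz)
      have h4 := congrArg f' h3
      rw [map_mul, map_sub, map_one, AlgHom.commutes] at h4
      exact h4
    change L (g z • resolvent x z) = _
    rw [map_smul]
    change g z • f' (resolvent x z) = _
    rw [eq_inv_of_mul_eq_one_left h2, smul_eq_mul, smul_eq_mul, mul_comm]
  have hchar0 : ∀ f : Unitization ℂ C →ₐ[ℂ] ℂ, f (a : Unitization ℂ C) = 0 →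
      f (WithLp.ofLp V) = 0 := by
    intro f hf
    -- For `f a = 0` the integrand is `g z / z`, holomorphic on the closed disc because 0 is
    -- outside.
    rw [hchar, hf, DiffContOnCl.circleIntegral_eq_zero hR.le, smul_zero]
    refine (DifferentiableOn.mono (t := Metric.closedBall c R) ?_
      Metric.closure_ball_subset_closedBall).diffContOnCl
    simp only [sub_zero]
    refine DifferentiableOn.smul (differentiableOn_id.inv fun z hz hz0 => ?_) hg
    exact h0 (hz0 ▸ hz)
  have hV : ((WithLp.ofLp V).snd : Unitization ℂ C) = WithLp.ofLp V := by
    -- The scalar part is itself a character killing `a`, so `V` has no scalar part and belongs to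
    -- `C`.
    have h := hchar0 (Unitization.fstHom ℂ C) (Unitization.fst_inr ℂ a)
    exact Unitization.ext h.symm rfl
  refine ⟨(WithLp.ofLp V).snd, fun f => ⟨fun hf => ?_, fun hf => ?_⟩⟩
  · rw [hV]
    exact hchar0 f hf
  · rw [hV, hchar f]
    have hd := (hg.mono Metric.closure_ball_subset_closedBall).diffContOnCl
    exact hd.two_pi_i_inv_smul_circleIntegral_sub_inv_smul ((ha f).resolve_left hf)

/-- Reduces identities modulo the radical to identities between complex numbers. -/
theorem modRad_eq_iff (a b : C) : modRad a = modRad b ↔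
    ∀ f : Unitization ℂ C →ₐ[ℂ] ℂ, f (a : Unitization ℂ C) = f (b : Unitization ℂ C) := by
  refine (Submodule.Quotient.eq (radical C)).trans ?_
  refine (rho_eq_zero_iff_forall_algHom C (a - b)).trans (forall_congr' fun f => ?_)
  rw [Unitization.inr_sub, map_sub, sub_eq_zero]

/-- The exponential series in `C / rad C` is computed by means of the characters. -/
theorem isExp_modRad {e v w : C}
    (h : ∀ f : Unitization ℂ C →ₐ[ℂ] ℂ, f (w : Unitization ℂ C) =
      Complex.exp (f (v : Unitization ℂ C)) * f (e : Unitization ℂ C)) :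
    IsExp (modRad e) (modRad v) (modRad w) := by
  have hnorm : ∀ n : ℕ, ‖((fun x => v * x)^[n] e)‖ ≤ ‖v‖ ^ n * ‖e‖ := by
    intro n
    induction n with
    | zero => simp
    | succ n ih =>
      rw [Function.iterate_succ_apply', pow_succ', mul_assoc]
      exact (norm_mul_le _ _).trans (by gcongr)
  have hsum : Summable fun n : ℕ => ((n.factorial : ℂ)⁻¹) • ((fun x => v * x)^[n] e) := by
    refine Summable.of_norm_bounded
      ((Real.summable_pow_div_factorial ‖v‖).mul_right ‖e‖) fun n => ?_
    rw [norm_smul, norm_inv, Complex.norm_natCast, div_mul_eq_mul_div, div_eq_inv_mul]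
    gcongr
    exact hnorm n
  -- The series is summed in the complete algebra `C`; its sum has the same characters as `w`.
  have hw : modRad w = modRad (∑' n : ℕ, ((n.factorial : ℂ)⁻¹) • ((fun x => v * x)^[n] e)) := by
    rw [modRad_eq_iff]
    intro f
    have hpow : ∀ n : ℕ, charCLM f ((fun x => v * x)^[n] e) = charCLM f v ^ n * charCLM f e := by
      intro n
      induction n with
      | zero => simp
      | succ n ih => rw [Function.iterate_succ_apply', charCLM_mul, ih, pow_succ']; ring
    have h1 := hsum.hasSum.mapL (charCLM f)
    have h2 := (NormedSpace.expSeries_div_hasSum_exp (charCLM f v)).mul_right (charCLM f e)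
    rw [h f, Complex.exp_eq_exp_ℂ]
    refine h2.unique (h1.congr_fun fun n => ?_)
    rw [map_smul, hpow, smul_eq_mul]
    ring
  have hiter : ∀ n : ℕ, (fun x => modRad v * x)^[n] (modRad e)
      = modRad ((fun x => v * x)^[n] e) := by
    intro n
    induction n with
    | zero => rfl
    | succ n ih => rw [Function.iterate_succ_apply', ih, Function.iterate_succ_apply', modRad_mul]
  rw [hw, IsExp]
  have := hsum.hasSum.map (radical C).mkQ (by exact continuous_quot_mk)
  refine this.congr_fun fun n => ?_
  rw [hiter, Function.comp_apply, map_smul]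
  rfl

end FunctionalCalculus

/-- A differentiable function that is symmetric about the real axis and bounded on a sector is
controlled on the sector of half-angle `γ` by its values on a rotated copy. -/
theorem norm_le_on_sector_of_rotated {F : ℂ → ℂ} (hF : Differentiable ℂ F)
    (hconj : ∀ z, F (conj z) = conj (F z)) {γ δ C m : ℝ} (hγ : 0 < γ) (hγ2 : γ ≤ Real.pi / 2)
    (hC : ∀ w : ℂ, |w.im| ≤ δ → ‖F (Complex.exp w)‖ ≤ C) {ω : ℂ} (hω : ‖ω‖ = 1)
    (hωδ : |ω.arg| ≤ δ) (hm : ∀ s ∈ sector γ, ‖F (ω * s)‖ ≤ m) :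
    ∀ z ∈ sector γ, ‖F z‖ ≤ m := by
  intro z hz
  obtain ⟨w, hw, rfl⟩ := exists_exp_of_mem_sector hz
  -- In the logarithmic coordinate, multiplication by `ω` is translation by `i arg ω`.
  refine norm_le_of_norm_le_rotated (g := fun w => F (Complex.exp w)) (ψ := ω.arg) (C := C)
    (hF.comp Complex.differentiable_exp) (fun w => ?_) (fun w hw => hC w (hw.trans hωδ)) hγ
    (fun w hw => ?_) w hw
  · rw [Complex.exp_conj, hconj, Complex.norm_conj]
  · have h1 : Complex.exp (ω.arg * Complex.I) = ω := by
      simpa [hω] using Complex.norm_mul_exp_arg_mul_I ω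
    rw [Complex.exp_add, h1, mul_comm]
    exact hm _ (exp_mem_sector hγ2 hw)

/-! ### The two cases: unbounded and bounded exponents. -/

namespace AnalyticSemigroup

variable {α : ℝ} {B : Type*} [NonUnitalNormedRing B] [NormedSpace ℂ B] [IsScalarTower ℂ B B]
  [SMulCommClass ℂ B B] [CompleteSpace B] (T : AnalyticSemigroup α B)

/-- From `exp (Re (c t)) ≤ ‖T(t)‖` and `x + 1 ≤ exp x`. The bound does not depend on `c`, so it
disappears after division by `‖c‖ → ∞`. -/
theorem re_mul_le_norm {f : Unitization ℂ T.algebra →ₐ[ℂ] ℂ} {c : ℂ}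
    (hc : ∀ t : sector α, f (T.elem t : Unitization ℂ T.algebra) = Complex.exp (c * t))
    (t : sector α) : (c * t).re ≤ ‖T.elem t‖ := by
  have h := norm_algHom_unitization_le f (WithLp.toLp 1 (T.elem t : Unitization ℂ T.algebra))
  rw [WithLp.unitization_norm_inr, hc, Complex.norm_exp] at h
  linarith [Real.add_one_le_exp (c * t).re]

/-- If the exponents of the characters are unbounded, then a bound near zero for the functional
calculus with `F` passes to a bound for `F` on a rotated sector. -/
theorem exists_rotation_of_unbounded {F : ℂ → ℂ} (hF : Continuous F) {γ t₀ : ℝ} (ht₀ : 0 < t₀)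
    {m : ℝ≥0∞}
    (hm : ∀ (f : Unitization ℂ T.algebra →ₐ[ℂ] ℂ) (c : ℂ),
      (∀ t : sector α, f (T.elem t : Unitization ℂ T.algebra) = Complex.exp (c * t)) →
      ∀ t ∈ sector γ, ‖t‖ ≤ t₀ → (‖F (-c * t)‖₊ : ℝ≥0∞) ≤ m)
    (hunb : ∀ M : ℝ, ∃ (f : Unitization ℂ T.algebra →ₐ[ℂ] ℂ) (c : ℂ),
      (∀ t : sector α, f (T.elem t : Unitization ℂ T.algebra) = Complex.exp (c * t)) ∧ M < ‖c‖) :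
    ∃ ω : ℂ, ‖ω‖ = 1 ∧ (∀ s ∈ sector α, 0 ≤ (ω * s).re) ∧
      ∀ s ∈ sector γ, (‖F (ω * s)‖₊ : ℝ≥0∞) ≤ m := by
  choose f c hfc hc using fun n : ℕ => hunb n
  have hcpos : ∀ n, 0 < ‖c n‖ := fun n => (Nat.cast_nonneg n).trans_lt (hc n)
  have hmem : ∀ n, -c n / ‖c n‖ ∈ Metric.sphere (0 : ℂ) 1 := by
    intro n
    rw [mem_sphere_zero_iff_norm, norm_div, norm_neg, Complex.norm_real, norm_norm,
      div_self (hcpos n).ne']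
  obtain ⟨ω, hω, φ, hφ, hlim⟩ := (isCompact_sphere (0 : ℂ) 1).tendsto_subseq hmem
  have hinf : Filter.Tendsto (fun n => ‖c (φ n)‖) Filter.atTop Filter.atTop :=
    (Filter.tendsto_atTop_mono (fun n => (hc n).le) tendsto_natCast_atTop_atTop).comp
      hφ.tendsto_atTop
  have hinv := hinf.inv_tendsto_atTop
  refine ⟨ω, mem_sphere_zero_iff_norm.1 hω, fun s hs => ?_, fun s hs => ?_⟩
  · have h1 : Filter.Tendsto (fun n => (-c (φ n) / ‖c (φ n)‖ * s).re) Filter.atTop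
        (nhds (ω * s).re) :=
      (Complex.continuous_re.tendsto _).comp (hlim.mul_const s)
    have h2 : Filter.Tendsto (fun n => -(‖c (φ n)‖⁻¹ * ‖T.elem ⟨s, hs⟩‖)) Filter.atTop
        (nhds 0) := by
      simpa using (hinv.mul_const ‖T.elem ⟨s, hs⟩‖).neg
    refine le_of_tendsto_of_tendsto' h2 h1 fun n => ?_
    have h3 := T.re_mul_le_norm (hfc (φ n)) ⟨s, hs⟩
    have h4 : -c (φ n) / ‖c (φ n)‖ * s = ((‖c (φ n)‖⁻¹ : ℝ) : ℂ) * -(c (φ n) * s) := by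
      push_cast
      ring
    rw [h4, Complex.re_ofReal_mul, Complex.neg_re, mul_neg]
    exact neg_le_neg (mul_le_mul_of_nonneg_left h3 (inv_nonneg.2 (norm_nonneg _)))
  · have h1 : Filter.Tendsto (fun n => (‖F (-c (φ n) / ‖c (φ n)‖ * s)‖₊ : ℝ≥0∞)) Filter.atTop
        (nhds (‖F (ω * s)‖₊ : ℝ≥0∞)) :=
      ((ENNReal.continuous_coe.comp (continuous_nnnorm.comp hF)).tendsto _).comp
        (hlim.mul_const s)
    refine le_of_tendsto h1 ?_
    have h2 : Filter.Tendsto (fun n => ‖c (φ n)‖⁻¹ * ‖s‖) Filter.atTop (nhds 0) := by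
      simpa using hinv.mul_const ‖s‖
    -- For fixed `s`, the point `s / ‖c‖` eventually satisfies the restriction `‖t‖ ≤ t₀`; thus a
    -- bound near 0 controls the whole rotated sector.
    filter_upwards [h2.eventually_le_const ht₀] with n hn
    have h4 : -c (φ n) / ‖c (φ n)‖ * s = -c (φ n) * (((‖c (φ n)‖⁻¹ : ℝ) : ℂ) * s) := by
      push_cast
      ring
    rw [h4]
    refine hm _ _ (hfc (φ n)) _ (real_smul_mem_sector (inv_pos.2 (hcpos _)) hs) ?_
    rwa [norm_mul, Complex.norm_real, Real.norm_of_nonneg (inv_nonneg.2 (norm_nonneg _))]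

/-- If the exponents of the characters are bounded, then modulo the radical the algebra has a unit
and the semigroup has a bounded generator. -/
theorem exists_generator_of_bounded (h0 : 0 < α) (hα : α ≤ Real.pi / 2) {M : ℝ}
    (hM : ∀ (f : Unitization ℂ T.algebra →ₐ[ℂ] ℂ) (c : ℂ),
      (∀ t : sector α, f (T.elem t : Unitization ℂ T.algebra) = Complex.exp (c * t)) → ‖c‖ ≤ M) :
    ∃ e : ModRadical T.algebra, IsUnitElement e ∧
      ∃ u : ModRadical T.algebra, ∀ t : sector α, IsExp e ((t : ℂ) • u) (modRad (T.elem t)) := by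
  -- This makes `‖c r‖ ≤ 1/8`, so `|exp (c r) - 1| ≤ 1/4` falls in the disc of radius `1/2`, and
  -- `log` recovers `c r` from `exp (c r)`.
  set r : ℝ := (8 * (|M| + 1))⁻¹ with hr
  have hr0 : 0 < r := by positivity
  have hrM : ∀ (f : Unitization ℂ T.algebra →ₐ[ℂ] ℂ) (c : ℂ),
      (∀ t : sector α, f (T.elem t : Unitization ℂ T.algebra) = Complex.exp (c * t)) →
      ‖c * r‖ ≤ 1 / 8 := by
    intro f c hc
    rw [norm_mul, Complex.norm_real, Real.norm_of_nonneg hr0.le, hr, ← div_eq_mul_inv,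
      div_le_iff₀ (by positivity)]
    linarith [hM f c hc, le_abs_self M]
  have hrs : (r : ℂ) ∈ sector α := by
    simpa using real_smul_mem_sector hr0 (⟨by simp, by simpa using h0⟩ : (1 : ℂ) ∈ sector α)
  set a := T.elem ⟨r, hrs⟩ with ha
  have hball : ∀ f : Unitization ℂ T.algebra →ₐ[ℂ] ℂ, f (a : Unitization ℂ T.algebra) = 0 ∨
      f (a : Unitization ℂ T.algebra) ∈ Metric.ball (1 : ℂ) (1 / 2) := by
    intro f
    rcases T.char_eq_zero_or_exp h0 hα f with h | ⟨c, hc⟩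
    · exact Or.inl (h a)
    · right
      have h1 := hrM f c hc
      rw [ha, hc, Metric.mem_ball, dist_eq_norm]
      have := Complex.norm_exp_sub_one_le (x := c * r) (by linarith)
      linarith
  have hn0 : (0 : ℂ) ∉ Metric.closedBall (1 : ℂ) (1 / 2) := by
    rw [Metric.mem_closedBall]; norm_num
  have hlog : DifferentiableOn ℂ (fun z => Complex.log z / r) (Metric.closedBall 1 (1 / 2)) := by
    refine (differentiableOn_id.clog fun z hz => Or.inl ?_).div_const _
    rw [Metric.mem_closedBall, dist_eq_norm] at hz
    have := (abs_le.1 ((Complex.abs_re_le_norm (z - 1)).trans hz)).1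
    simp only [Complex.sub_re, Complex.one_re] at this
    simp only [id]
    linarith
  -- On characters with exponent `c`, the element `e` takes the value 1 and `u` the value `c`; on
  -- all others both vanish.
  obtain ⟨e, he⟩ := exists_forall_char_eq (by norm_num) hn0 (differentiableOn_const (1 : ℂ)) a hball
  obtain ⟨u, hu⟩ := exists_forall_char_eq (by norm_num) hn0 hlog a hball
  have hchar : ∀ f : Unitization ℂ T.algebra →ₐ[ℂ] ℂ,
      (∀ b : T.algebra, f (b : Unitization ℂ T.algebra) = 0) ∨
      (f (e : Unitization ℂ T.algebra) = 1 ∧ ∀ t : sector α,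
        f (T.elem t : Unitization ℂ T.algebra) =
          Complex.exp (t * f (u : Unitization ℂ T.algebra))) := by
    intro f
    refine (T.char_eq_zero_or_exp h0 hα f).imp_right ?_
    rintro ⟨c, hc⟩
    have h1 : f (a : Unitization ℂ T.algebra) = Complex.exp (c * r) := hc _
    have h2 : f (a : Unitization ℂ T.algebra) ≠ 0 := h1 ▸ Complex.exp_ne_zero _
    have h3 : f (u : Unitization ℂ T.algebra) = c := by
      have h4 := abs_le.1 ((Complex.abs_im_le_norm (c * r)).trans (hrM f c hc))
      rw [(hu f).2 h2, h1, Complex.log_exp (by linarith [Real.pi_gt_three])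
        (by linarith [Real.pi_gt_three]), mul_div_cancel_right₀]
      exact_mod_cast hr0.ne'
    exact ⟨(he f).2 h2, fun t => by rw [hc, h3, mul_comm]⟩
  refine ⟨modRad e, fun x => ?_, modRad u, fun t => ?_⟩
  · obtain ⟨b, rfl⟩ := (radical T.algebra).mkQ_surjective x
    have h1 : modRad (e * b) = modRad b := by
      rw [modRad_eq_iff]
      intro f
      rw [Unitization.inr_mul, map_mul]
      rcases hchar f with h | ⟨h, -⟩
      · rw [h b, mul_zero]
      · rw [h, one_mul]
    have h2 : modRad (b * e) = modRad b := by rw [mul_comm, h1]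
    exact ⟨h1, h2⟩
  · refine isExp_modRad (v := (t : ℂ) • u) fun f => ?_
    rw [Unitization.inr_smul, map_smul, smul_eq_mul]
    rcases hchar f with h | ⟨h, h'⟩
    · rw [h, h e, mul_zero]
    · rw [h, h', mul_one]

end AnalyticSemigroup

end

/-! ### Proof of the theorem. -/

theorem theorem3p4 {B : Type*} [NonUnitalNormedRing B] [NormedSpace ℂ B] [IsScalarTower ℂ B B]
    [SMulCommClass ℂ B B] [CompleteSpace B]
    (α β : ℝ) (hα : α < Real.pi / 2) (hβ : 0 ≤ β) (hβα : β < α)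
    (φ : holomorphicOnSector α →L[ℂ] ℂ) (μ : ComplexMeasure (sector α))
    (hφ : IsInducedBy φ μ) (hμc : HasCompactSupp μ) (hμβ : CarriedBy μ {ξ | |(ξ : ℂ).arg| ≤ β})
    (hμs : IsSymmetricMeasure μ) (hμ0 : μ Set.univ = 0)
    (T : AnalyticSemigroup α B) (hT : ¬ T.IsQuasinilpotent)
    (t₀ : ℝ) (ht₀ : 0 < t₀)
    (hlt : ⨆ t ∈ {t : ℂ | t ∈ sector (α - β) ∧ ‖t‖ ≤ t₀}, rho (T.calculus μ t)
      < ⨆ z ∈ sector (α - β), (‖fourierBorel φ z‖₊ : ℝ≥0∞)) :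
    ∃ e : ModRadical T.algebra, IsUnitElement e ∧
      ∃ u : ModRadical T.algebra, ∀ t : sector α, IsExp e ((t : ℂ) • u) (modRad (T.elem t)) := by
  have h0 : 0 < α := hβ.trans_lt hβα
  set m : ℝ≥0∞ := ⨆ t ∈ {t : ℂ | t ∈ sector (α - β) ∧ ‖t‖ ≤ t₀}, rho (T.calculus μ t) with hm
  obtain ⟨K, hK, hKβ, hp⟩ := exists_compact_carrier hμc hμβ
  have hfb : fourierBorel φ = fun z => cintegral μ fun ξ : sector α => Complex.exp (-z * (ξ : ℂ)) :=
    funext fun z => hφ (expNeg α z)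
  have hF : Differentiable ℂ (fourierBorel φ) := hfb ▸ cintegral_exp_differentiable hK hp
  have hconj : ∀ z, fourierBorel φ (conj z) = conj (fourierBorel φ z) := by
    rw [hfb]
    exact cintegral_exp_conj hK hp hμs
  obtain ⟨C, hC⟩ := exists_norm_cintegral_exp_le (μ := μ)
  by_cases hbdd : ∃ M : ℝ, ∀ (f : Unitization ℂ T.algebra →ₐ[ℂ] ℂ) (c : ℂ),
      (∀ t : sector α, f (T.elem t : Unitization ℂ T.algebra) = Complex.exp (c * t)) → ‖c‖ ≤ M
  · obtain ⟨M, hM⟩ := hbdd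
    exact T.exists_generator_of_bounded h0 hα.le hM
  push Not at hbdd
  exfalso
  obtain ⟨ω, hω, hωre, hωm⟩ := T.exists_rotation_of_unbounded hF.continuous (γ := α - β) ht₀
    (m := m) (fun f c hc t ht htn => by
      have h1 := T.nnnorm_cintegral_exp_le_rho_calculus hα.le hK hKβ hp hc ht
      rw [hfb]
      simp only [neg_mul, neg_neg]
      exact h1.trans (le_iSup₂_of_le t ⟨ht, htn⟩ le_rfl)) hbdd
  have hmtop : m ≠ ⊤ := hlt.ne_top
  refine absurd hlt (not_lt.2 (iSup₂_le fun z hz => ?_))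
  -- The half-angle `δ = π/2 - α` is that of the polar sector, which contains `ω` and on which the
  -- transform is bounded by `C`.
  have hbound := norm_le_on_sector_of_rotated hF hconj (γ := α - β) (δ := Real.pi / 2 - α)
    (m := m.toReal) (sub_pos.2 hβα) (by linarith) (by rw [hfb]; exact hC) hω
    (abs_arg_le_of_forall_re_mul_nonneg h0 hα.le hω hωre) (fun s hs => by
      simpa using ENNReal.toReal_mono hmtop (hωm s hs)) z hz
  rw [← ENNReal.ofReal_toReal hmtop, ← enorm_eq_nnnorm, ← ofReal_norm]
  exact ENNReal.ofReal_le_ofReal hbound
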